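/- Let $N\ge 2$ and $K_1,\dots,K_N\in\mathbb R$ (heterogeneous gains). For $\theta\in\mathbb T^N=(\mathbb R/2\pi\mathbb Z)^N$ put $$p_\theta=\frac1N\sum_{k=1}^N e^{i\theta_k},\qquad U(\theta)=\frac N2|p_\theta|^2,\qquad T_k(\theta)=\Big(\frac{\partial U}{\partial\theta_k}(\theta)\Big)^2 .$$ Consider $N$ unicycle agents $\dot r_k=e^{i\theta_k}$, $\dot\theta_k=u_k$ (position $r_k\in\mathbb C$, heading $\theta_k$) under the control law $u_k=-K_k\,\partial U/\partial\theta_k$; "solution" means a solution $(r(t),\theta(t))$ on $[0,\infty)$ of this closed loop. Let $\mathcal B=\{\theta\in\mathbb T^N: p_\theta=0\}$ be the set of balanced phase arrangements and $\Lambda=\{\theta\in\mathbb T^N:\partial U/\partial\theta_k(\theta)=0\ \forall k\}$ the critical set of $U$. On a set $D\subseteq\mathbb T^N$ consider the condition $$(\ast)\qquad \sum_{k=1}^N K_kT_k(\theta)>0\quad\text{for every }\theta\in D\setminus\Lambda .$$ (At points of $\Lambda$ the sum is always $0$.) A set $A\subseteq\mathbb T^N$ is stable if for every neighbourhood $V$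 of $A$ there is a neighbourhood $W$ of $A$ such that every solution with $\theta(0)\in W$ has $\theta(t)\in V$ for all $t\ge0$; it is asymptotically stable if moreover every solution whose $\theta(0)$ lies in some fixed neighbourhood of $A$ satisfies $\theta(t)\to A$ as $t\to\infty$. 1. If $(\ast)$ holds on some neighbourhood $D$ of $\mathcal B$ (for example on $D=\mathbb T^N$), then balanced formation is asymptotically stable, i.e. $\mathcal B$ is asymptotically stable. 2. If $(\ast)$ holds on a closed set $D$ (for example on $D=\mathbb T^N$), then every solution with $\theta(t)\in D$ for all $t\ge0$ satisfies $\theta(t)\to\Lambda\cap D$. In particular, if $D$ contains no critical point of $U$ with $p_\theta\ne0$, then $\theta(t)\to\mathcal B$ and $p_{\theta(t)}\to0$ as $t\to\infty$. 3. The condition $K_k>0$ for all $k$ is a (restricted) sufficient condition: it implies $(\ast)$ on all of $\mathbb T^N$, and $\mathcal B$ is asymptotically stable. In that case every solution satisfies $\theta(t)\to\mathcal B$ or $\theta(t)\to\Lambda\setminus\mathcal B$, and every critical point $\theta$ of $U$ with $p_\theta\neq0$ is an unstable equilibrium of the phase dynamics (an equilibrium $\theta$ such that $\{\theta\}$ is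 not stable), and it is either a global maximum point of $U$ with $|p_\theta|=1$, or a saddle point of $U$ (a critical point that is neither a local minimum nor a local maximum) with $|p_\theta|<1$. -/

import Mathlib

open Set Filter Topology

namespace Unicycle

noncomputable section

/-- The `N`-torus of heading angles; `Real.Angle` is `ℝ / 2πℤ`. -/
abbrev Torus (N : ℕ) : Type := Fin N → Real.Angle

/-- Reduction of real heading angles modulo `2π`. -/
def toTorus {N : ℕ} (x : Fin N → ℝ) : Torus N := fun k => (x k : Real.Angle)

/-- The average linear momentum (phase order parameter) `p_θ = (1/N) ∑ₖ exp(i θₖ)`. -/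
def momentum {N : ℕ} (θ : Torus N) : ℂ :=
  (1 / (N : ℂ)) * ∑ k, ((θ k).toCircle : ℂ)

/-- The potential `U(θ) = (N/2) |p_θ|²`. -/
def potential {N : ℕ} (θ : Torus N) : ℝ :=
  (N : ℝ) / 2 * ‖momentum θ‖ ^ 2

/-- The partial derivative `∂f/∂θₖ` at `θ` of a function `f` on the torus. -/
def pderiv {N : ℕ} (k : Fin N) (f : Torus N → ℝ) (θ : Torus N) : ℝ :=
  deriv (fun s : ℝ => f (θ + Pi.single k (s : Real.Angle))) 0

/-- The feedback control law `uₖ = -Kₖ ∂U/∂θₖ`. -/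
def control {N : ℕ} (K : Fin N → ℝ) (θ : Torus N) (k : Fin N) : ℝ :=
  -K k * pderiv k potential θ

/-- The term `Tₖ(θ) = (∂U/∂θₖ)²`. -/
def termT {N : ℕ} (k : Fin N) (θ : Torus N) : ℝ :=
  pderiv k potential θ ^ 2

/-- `(r, θ)` is a solution on `[0, ∞)` of the unicycle model `ṙₖ = exp(i θₖ)`, `θ̇ₖ = uₖ` in
closed loop with the control law `uₖ = -Kₖ ∂U/∂θₖ`. The heading angles are written as real-valued
functions; the phases of the agents are their classes in the torus. -/
structure IsSolution {N : ℕ} (K : Fin N → ℝ) (r : ℝ → Fin N → ℂ) (θ : ℝ → Fin N → ℝ) :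
    Prop where
  position : ∀ t, 0 ≤ t → ∀ k,
    HasDerivWithinAt (fun s => r s k) (Complex.exp (Complex.I * (θ t k : ℂ))) (Ici 0) t
  heading : ∀ t, 0 ≤ t → ∀ k,
    HasDerivWithinAt (fun s => θ s k) (control K (toTorus (θ t)) k) (Ici 0) t

/-- The set of balanced phase arrangements. -/
def balanced (N : ℕ) : Set (Torus N) := {θ | momentum θ = 0}

/-- The set of critical points of the potential. -/
def critical (N : ℕ) : Set (Torus N) := {θ | ∀ k, pderiv k potential θ = 0}

/-- Lyapunov stability of a set `A` of phase arrangements: solutions that start close to `A` stay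
close to `A`. (The torus is compact, so for closed `A` the neighbourhoods of `A` are the sets that
contain an `ε`-neighbourhood of `A`.) -/
def IsStable {N : ℕ} (K : Fin N → ℝ) (A : Set (Torus N)) : Prop :=
  ∀ V ∈ 𝓝ˢ A, ∃ W ∈ 𝓝ˢ A, ∀ r θ, IsSolution K r θ → toTorus (θ 0) ∈ W →
    ∀ t, 0 ≤ t → toTorus (θ t) ∈ V

/-- The phases of the agents converge to the set `A` as `t → ∞`. -/
def ConvergesTo {N : ℕ} (θ : ℝ → Fin N → ℝ) (A : Set (Torus N)) : Prop :=
  Tendsto (fun t => toTorus (θ t)) atTop (𝓝ˢ A)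

/-- Asymptotic stability of a set `A` of phase arrangements: `A` is Lyapunov stable, and solutions
that start close to `A` converge to `A`. -/
def IsAsymptoticallyStable {N : ℕ} (K : Fin N → ℝ) (A : Set (Torus N)) : Prop :=
  IsStable K A ∧
    ∃ W ∈ 𝓝ˢ A, ∀ r θ, IsSolution K r θ → toTorus (θ 0) ∈ W → ConvergesTo θ A

/-- An unstable equilibrium of the phase dynamics. -/
def IsUnstableEquilibrium {N : ℕ} (K : Fin N → ℝ) (φ : Torus N) : Prop :=
  (∀ k, control K φ k = 0) ∧ ¬ IsStable K {φ}

/-- A saddle point of the potential: a critical point that is no local extremum. -/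
def IsSaddle {N : ℕ} (φ : Torus N) : Prop :=
  φ ∈ critical N ∧ ¬ IsLocalMin potential φ ∧ ¬ IsLocalMax potential φ

/-- The condition `∑ₖ Kₖ Tₖ(θ) > 0` on a region `D`. At a critical point of the potential every
`Tₖ` vanishes, so the condition is imposed at the other points of `D`. -/
def GainCondition {N : ℕ} (K : Fin N → ℝ) (D : Set (Torus N)) : Prop :=
  ∀ θ ∈ D, θ ∉ critical N → 0 < ∑ k, K k * termT k θ

end

end Unicycle

/-! Along solutions the potential has derivative `-∑ k, K k * termT k θ`, so under the gain
condition it is a Lyapunov function. Headings move at bounded speed and the torus is compact, so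
Barbalat's lemma sends this rate to zero. Since the rate is bounded below away from neighbourhoods
of the critical set, the phases converge to critical points.

The rest depends on the critical values. At an unbalanced critical point the phases form two
antipodal clusters, so `N * momentum` is a positive integer `M` times a unit vector and `2 * N *
potential = M ^ 2`. Critical values are therefore discrete, and only balanced points are critical
where `2 * N * potential < 1`. As small sublevel sets form a neighbourhood basis of the balanced
set, this gives asymptotic stability.

Instability needs no linearization: opposite rotations of two phases in the larger cluster lower the
potential, and a solution started there cannot stop in the gap below the critical value. -/

open Complex in
theorem Real.Angle.continuous_coe_toCircle :
    Continuous fun θ : Real.Angle => (θ.toCircle : ℂ) := by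
  simp only [Real.Angle.coe_toCircle]
  exact (continuous_ofReal.comp Real.Angle.continuous_cos).add
    ((continuous_ofReal.comp Real.Angle.continuous_sin).mul continuous_const)

/-! ### The potential, its gradient and its critical points -/

namespace Unicycle

noncomputable section

variable {N : ℕ}

/-- The closed form of the partial derivatives of the potential. -/
def gradient (k : Fin N) (θ : Torus N) : ℝ :=
  inner ℝ (momentum θ) (Complex.I * ((θ k).toCircle : ℂ))

theorem continuous_momentum : Continuous (momentum : Torus N → ℂ) :=
  continuous_const.mul <| continuous_finsetSum _ fun k _ =>
    Real.Angle.continuous_coe_toCircle.comp (continuous_apply k)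

theorem continuous_potential : Continuous (potential : Torus N → ℝ) :=
  continuous_const.mul (continuous_momentum.norm.pow 2)

theorem continuous_gradient (k : Fin N) : Continuous (gradient k) :=
  continuous_momentum.inner <| continuous_const.mul <|
    Real.Angle.continuous_coe_toCircle.comp (continuous_apply k)

theorem exists_toTorus_eq (θ : Torus N) : ∃ x, toTorus x = θ := by
  have h : ∀ k, ∃ y : ℝ, (y : Real.Angle) = θ k := fun k =>
    Real.Angle.induction_on (θ k) fun y => ⟨y, rfl⟩
  choose x hx using h
  exact ⟨x, funext hx⟩

theorem coe_toCircle_toTorus (x : Fin N → ℝ) (k : Fin N) :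
    ((toTorus x k).toCircle : ℂ) = Complex.exp (x k * Complex.I) := by
  simp [toTorus, Circle.coe_exp]

/-- The chain rule for the potential along a curve of real heading angles. -/
theorem hasDerivWithinAt_potential (hN : N ≠ 0) {x : ℝ → Fin N → ℝ} {v : Fin N → ℝ}
    {s : Set ℝ} {t : ℝ} (h : ∀ k, HasDerivWithinAt (fun τ => x τ k) (v k) s t) :
    HasDerivWithinAt (fun τ => potential (toTorus (x τ)))
      (∑ k, v k * gradient k (toTorus (x t))) s t := by
  have h1 : ∀ k, HasDerivWithinAt (fun τ => ((toTorus (x τ) k).toCircle : ℂ))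
      ((v k : ℂ) * (Complex.I * ((toTorus (x t) k).toCircle : ℂ))) s t := by
    intro k
    simp only [coe_toCircle_toTorus]
    convert ((h k).ofReal_comp.mul_const Complex.I).cexp using 1
    ring
  have h2 : HasDerivWithinAt (fun τ => momentum (toTorus (x τ)))
      ((1 / (N : ℂ)) * ∑ k, (v k : ℂ) * (Complex.I * ((toTorus (x t) k).toCircle : ℂ))) s t :=
    (HasDerivWithinAt.fun_sum fun k _ => h1 k).const_mul _
  refine (h2.norm_sq.const_mul ((N : ℝ) / 2)).congr_deriv ?_
  have hN' : (N : ℝ) ≠ 0 := by exact_mod_cast hN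
  have h3 : (1 / (N : ℂ)) * ∑ k, (v k : ℂ) * (Complex.I * ((toTorus (x t) k).toCircle : ℂ)) =
      (1 / (N : ℝ)) • ∑ k, v k • (Complex.I * ((toTorus (x t) k).toCircle : ℂ)) := by
    simp [Complex.real_smul]
  rw [h3, inner_smul_right, inner_sum]
  simp only [inner_smul_right, gradient]
  field_simp

theorem pderiv_potential (k : Fin N) (θ : Torus N) : pderiv k potential θ = gradient k θ := by
  obtain ⟨x, rfl⟩ := exists_toTorus_eq θ
  have hN : N ≠ 0 := by rintro rfl; exact k.elim0
  have hx : ∀ s : ℝ, toTorus x + Pi.single k (s : Real.Angle) =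
      toTorus (fun j => x j + if j = k then s else 0) := by
    intro s
    funext j
    by_cases hj : j = k
    · subst hj; simp [toTorus]
    · simp [toTorus, hj]
  have h := hasDerivWithinAt_potential (s := univ) (t := 0) hN
    (x := fun s j => x j + if j = k then s else 0) (v := fun j => if j = k then 1 else 0) (by
      intro j
      by_cases hj : j = k
      · simpa [hj] using (hasDerivWithinAt_id (0 : ℝ) univ).const_add (x k)
      · simpa [hj] using hasDerivWithinAt_const (0 : ℝ) univ (x j))
  rw [hasDerivWithinAt_univ] at h
  simp only [← hx] at h
  rw [pderiv, h.deriv]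
  simp

theorem control_eq (K : Fin N → ℝ) (θ : Torus N) (k : Fin N) :
    control K θ k = -K k * gradient k θ := by
  rw [control, pderiv_potential]

theorem termT_eq (k : Fin N) (θ : Torus N) : termT k θ = gradient k θ ^ 2 := by
  rw [termT, pderiv_potential]

theorem mem_critical_iff {θ : Torus N} : θ ∈ critical N ↔ ∀ k, gradient k θ = 0 := by
  simp [critical, pderiv_potential]

theorem potential_nonneg (θ : Torus N) : 0 ≤ potential θ := by
  unfold potential; positivity

theorem mem_balanced_iff_potential (hN : N ≠ 0) {θ : Torus N} :
    θ ∈ balanced N ↔ potential θ = 0 := by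
  simp [balanced, potential, hN]

theorem nat_mul_momentum (hN : N ≠ 0) (θ : Torus N) :
    (N : ℂ) * momentum θ = ∑ k, ((θ k).toCircle : ℂ) := by
  have : (N : ℂ) ≠ 0 := by exact_mod_cast hN
  rw [momentum]; field_simp

theorem norm_momentum_le_one (θ : Torus N) : ‖momentum θ‖ ≤ 1 := by
  rcases eq_or_ne N 0 with rfl | hN
  · simp [momentum]
  have h : ‖(N : ℂ) * momentum θ‖ ≤ N := by
    rw [nat_mul_momentum hN]
    refine (norm_sum_le _ _).trans ?_
    simp only [Circle.norm_coe]
    simp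
  rw [norm_mul, Complex.norm_natCast] at h
  have : (0 : ℝ) < N := by exact_mod_cast Nat.pos_of_ne_zero hN
  nlinarith

theorem two_mul_potential (hN : N ≠ 0) (θ : Torus N) :
    2 * N * potential θ = ‖∑ k, ((θ k).toCircle : ℂ)‖ ^ 2 := by
  rw [← nat_mul_momentum hN, norm_mul, Complex.norm_natCast, potential]
  ring

/-- A critical point that is not balanced is an arrangement of phases in two antipodal clusters,
the larger one in the direction of the momentum. -/
theorem exists_sign_of_mem_critical {θ : Torus N} (hθ : θ ∈ critical N) (hp : momentum θ ≠ 0) :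
    ∃ u : ℂ, ‖u‖ = 1 ∧ ∃ σ : Fin N → ℤ, (∀ k, σ k = 1 ∨ σ k = -1) ∧
      (∀ k, ((θ k).toCircle : ℂ) = σ k * u) ∧ 0 < ∑ k, σ k := by
  have hN : N ≠ 0 := by rintro rfl; simp [momentum] at hp
  have hp' : (0 : ℝ) < ‖momentum θ‖ := norm_pos_iff.2 hp
  have hp'' : ((‖momentum θ‖ : ℝ) : ℂ) ≠ 0 := by exact_mod_cast hp'.ne'
  set u : ℂ := momentum θ / ‖momentum θ‖ with hu
  have hu1 : ‖u‖ = 1 := by simp [hu, hp'.ne']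
  have hpu : momentum θ = ‖momentum θ‖ * u := by rw [hu]; field_simp
  have key : ∀ k, ∃ σ : ℤ, (σ = 1 ∨ σ = -1) ∧ ((θ k).toCircle : ℂ) = σ * u := by
    intro k
    have hz : ‖((θ k).toCircle : ℂ)‖ = 1 := Circle.norm_coe _
    have hg := mem_critical_iff.1 hθ k
    set z : ℂ := ((θ k).toCircle : ℂ) with hzdef
    rw [gradient, hpu, ← Complex.real_smul, inner_smul_left] at hg
    -- Criticality makes `I * z` orthogonal to `u`, so `z` times the conjugate of `u` is real;
    -- having modulus one, it is `±1`.
    have him : (z * (starRingEnd ℂ) u).im = 0 := by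
      have : inner ℝ u (Complex.I * z) = 0 := by
        rcases mul_eq_zero.1 hg with h | h
        · simp [hp] at h
        · exact h
      rw [Complex.inner] at this
      simp at this ⊢
      linarith
    have hsq : (z * (starRingEnd ℂ) u).re ^ 2 = 1 := by
      have h1 : ‖z * (starRingEnd ℂ) u‖ ^ 2 = 1 := by simp [hz, hu1]
      rw [Complex.sq_norm, Complex.normSq_apply, him] at h1
      linarith
    have huu : (starRingEnd ℂ) u * u = 1 := by
      rw [mul_comm, Complex.mul_conj, Complex.normSq_eq_norm_sq, hu1]; simp
    have hz2 : z = (z * (starRingEnd ℂ) u) * u := by rw [mul_assoc, huu, mul_one]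
    have hre : z * (starRingEnd ℂ) u = ((z * (starRingEnd ℂ) u).re : ℂ) :=
      Complex.ext rfl (by simpa using him)
    rcases sq_eq_one_iff.1 hsq with h | h
    · exact ⟨1, Or.inl rfl, by rw [hz2, hre, h]; simp⟩
    · exact ⟨-1, Or.inr rfl, by rw [hz2, hre, h]; simp⟩
  choose σ hσ hz using key
  refine ⟨u, hu1, σ, hσ, hz, ?_⟩
  have hsum : (N : ℂ) * momentum θ = ((∑ k, σ k : ℤ) : ℂ) * u := by
    rw [nat_mul_momentum hN, Int.cast_sum, Finset.sum_mul]
    exact Finset.sum_congr rfl fun k _ => hz k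
  have hu0 : u ≠ 0 := by intro h; simp [h] at hu1
  have h2 : ((N * ‖momentum θ‖ : ℝ) : ℂ) = ((∑ k, σ k : ℤ) : ℝ) := by
    apply mul_right_cancel₀ hu0
    push_cast at hsum ⊢
    rw [← hsum, mul_assoc, ← hpu]
  have h3 : (N * ‖momentum θ‖ : ℝ) = ((∑ k, σ k : ℤ) : ℝ) := by exact_mod_cast h2
  have : (0 : ℝ) < ((∑ k, σ k : ℤ) : ℝ) := by
    rw [← h3]
    have : (0 : ℝ) < N := by exact_mod_cast Nat.pos_of_ne_zero hN
    positivity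
  exact_mod_cast this

theorem norm_sum_of_sign {θ : Torus N} {u : ℂ} (hu : ‖u‖ = 1) {σ : Fin N → ℤ}
    (h : ∀ k, ((θ k).toCircle : ℂ) = σ k * u) (hpos : 0 < ∑ k, σ k) :
    ‖∑ k, ((θ k).toCircle : ℂ)‖ = (∑ k, σ k : ℤ) := by
  have : ∑ k, ((θ k).toCircle : ℂ) = ((∑ k, σ k : ℤ) : ℂ) * u := by
    rw [Int.cast_sum, Finset.sum_mul]
    exact Finset.sum_congr rfl fun k _ => h k
  rw [this, norm_mul, hu, Complex.norm_intCast, mul_one]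
  exact abs_of_pos (by exact_mod_cast hpos)

/-- The critical values of the potential are of the form `m² / (2N)`. -/
theorem exists_int_potential_eq (hN : N ≠ 0) {θ : Torus N} (hθ : θ ∈ critical N) :
    ∃ m : ℤ, 2 * N * potential θ = (m : ℝ) ^ 2 := by
  by_cases hp : momentum θ = 0
  · exact ⟨0, by simp [potential, hp]⟩
  · obtain ⟨u, hu, σ, -, hz, hpos⟩ := exists_sign_of_mem_critical hθ hp
    exact ⟨_, by rw [two_mul_potential hN, norm_sum_of_sign hu hz hpos]⟩

/-- Distinct critical values of the potential are separated by a gap. -/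
theorem potential_le_of_mem_critical (hN : N ≠ 0) {θ φ : Torus N} (hθ : θ ∈ critical N)
    (hφ : φ ∈ critical N) (h : 2 * N * potential φ < 2 * N * potential θ + 1) :
    potential φ ≤ potential θ := by
  obtain ⟨m, hm⟩ := exists_int_potential_eq hN hθ
  obtain ⟨n, hn⟩ := exists_int_potential_eq hN hφ
  have hN' : (0 : ℝ) < N := by exact_mod_cast Nat.pos_of_ne_zero hN
  rw [hm, hn] at h
  have h1 : n ^ 2 ≤ m ^ 2 := by
    have : n ^ 2 < m ^ 2 + 1 := by exact_mod_cast h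
    omega
  have h2 : (n : ℝ) ^ 2 ≤ (m : ℝ) ^ 2 := by exact_mod_cast h1
  rw [← hm, ← hn] at h2
  exact le_of_mul_le_mul_left h2 (by positivity)

theorem sum_toCircle_update {θ : Torus N} (j : Fin N) (s : Real.Angle) :
    ∑ k, (((θ + Pi.single j s : Torus N) k).toCircle : ℂ) =
      ∑ k, ((θ k).toCircle : ℂ) + ((θ j).toCircle : ℂ) * ((s.toCircle : ℂ) - 1) := by
  have : ∀ k, (((θ + Pi.single j s : Torus N) k).toCircle : ℂ) =
      ((θ k).toCircle : ℂ) + if k = j then ((θ j).toCircle : ℂ) * ((s.toCircle : ℂ) - 1) else 0 := by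
    intro k
    by_cases hk : k = j
    · subst hk; simp [Real.Angle.toCircle_add]; ring
    · simp [hk]
  simp only [this, Finset.sum_add_distrib]
  simp

/-- A single plus sign would give the sum `1 - (N - 1) = 2 - N ≤ 0`. -/
theorem exists_ne_of_sum_pos (hN : 2 ≤ N) {σ : Fin N → ℤ} (hσ : ∀ k, σ k = 1 ∨ σ k = -1)
    (hpos : 0 < ∑ k, σ k) : ∃ i j, i ≠ j ∧ σ i = 1 ∧ σ j = 1 := by
  obtain ⟨i, -, hi⟩ := Finset.exists_lt_of_sum_lt (s := Finset.univ) (f := fun _ : Fin N => (0 : ℤ))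
    (g := σ) (by simpa using hpos)
  have hi1 : σ i = 1 := by have := hσ i; omega
  by_contra! hcon
  have h1 : ∀ j ∈ Finset.univ.erase i, σ j = -1 := by
    intro j hj
    have := hcon i j (Finset.ne_of_mem_erase hj).symm hi1
    have := hσ j
    tauto
  rw [← Finset.add_sum_erase _ _ (Finset.mem_univ i), Finset.sum_congr rfl h1] at hpos
  simp [hi1] at hpos
  omega

/-- Rotating two phases of the larger cluster by `s` and `-s` keeps the phase sum parallel to `u`
and shortens it from `M` to `M - 2 * (1 - cos s)`. -/
theorem not_isLocalMin_potential (hN : 2 ≤ N) {φ : Torus N} (hφ : φ ∈ critical N)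
    (hp : momentum φ ≠ 0) : ¬ IsLocalMin potential φ := by
  intro hmin
  obtain ⟨u, hu, σ, hσ, hz, hpos⟩ := exists_sign_of_mem_critical hφ hp
  obtain ⟨i, j, hij, hi, hj⟩ := exists_ne_of_sum_pos hN hσ hpos
  have hN0 : N ≠ 0 := by omega
  set γ : ℝ → Torus N := fun s =>
    φ + Pi.single i (s : Real.Angle) + Pi.single j ((-s : ℝ) : Real.Angle) with hγ
  have hγc : Continuous γ := by
    have h1 : Continuous fun s : ℝ => (s : Real.Angle) := Real.Angle.continuous_coe
    have h2 : Continuous fun s : ℝ => ((-s : ℝ) : Real.Angle) := h1.comp continuous_neg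
    exact (continuous_const.add ((continuous_single (A := fun _ => Real.Angle) i).comp h1)).add
      ((continuous_single (A := fun _ => Real.Angle) j).comp h2)
  have hγ0 : γ 0 = φ := by simp [hγ]
  set M : ℤ := ∑ k, σ k with hM
  have hM1 : (1 : ℝ) ≤ M := by exact_mod_cast hpos
  have hsum : ∑ k, ((φ k).toCircle : ℂ) = (M : ℂ) * u := by
    rw [hM, Int.cast_sum, Finset.sum_mul]
    exact Finset.sum_congr rfl fun k _ => hz k
  have hval : ∀ s, 2 * N * potential (γ s) = (M - 2 * (1 - Real.cos s)) ^ 2 := by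
    intro s
    rw [two_mul_potential hN0, hγ, sum_toCircle_update, sum_toCircle_update, hsum]
    have : (((φ + Pi.single i (s : Real.Angle)) : Torus N) j) = φ j := by simp [hij.symm]
    rw [this, hz i, hz j, hi, hj]
    have : (M : ℂ) * u + ((1 : ℤ) : ℂ) * u * (((s : Real.Angle).toCircle : ℂ) - 1) +
        ((1 : ℤ) : ℂ) * u * ((((-s : ℝ) : Real.Angle).toCircle : ℂ) - 1) =
        ((M - 2 * (1 - Real.cos s) : ℝ) : ℂ) * u := by
      rw [Real.Angle.toCircle_coe, Real.Angle.toCircle_coe, Circle.coe_exp, Circle.coe_exp]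
      push_cast
      rw [Complex.cos]
      ring
    rw [this, norm_mul, hu, Complex.norm_real, mul_one, Real.norm_eq_abs, sq_abs]
  have hev : ∀ᶠ s in 𝓝 (0 : ℝ), potential φ ≤ potential (γ s) :=
    (hγc.tendsto' 0 φ hγ0).eventually hmin
  obtain ⟨s, ⟨hs, hs1⟩, hs0 : s ∈ Ioi (0:ℝ)⟩ := ((hev.filter_mono nhdsWithin_le_nhds |>.and
    ((gt_mem_nhds one_pos).filter_mono nhdsWithin_le_nhds)).and
      (self_mem_nhdsWithin : Ioi (0 : ℝ) ∈ 𝓝[>] 0)).exists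
  simp only [mem_Ioi] at hs0
  have h1 := Real.one_sub_sq_div_two_le_cos (x := s)
  have h2 : Real.cos s < 1 := by
    simpa using Real.cos_lt_cos_of_nonneg_of_le_pi le_rfl (by linarith [Real.pi_gt_three]) hs0
  have h3 : 2 * N * potential φ = M ^ 2 := by
    have := hval 0; rw [hγ0] at this; simpa using this
  have h4 : (M : ℝ) ^ 2 ≤ (M - 2 * (1 - Real.cos s)) ^ 2 := by
    rw [← h3, ← hval]; gcongr
  have h5 : s ^ 2 < 1 := by nlinarith
  -- With `c = 1 - cos s`, the drop is `M ^ 2 - (M - 2 * c) ^ 2 = 4 * c * (M - c)`; `0 < s < 1`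
  -- ensures `0 < c < 1 ≤ M`.
  nlinarith [mul_pos (sub_pos.2 h2) (by linarith : (0 : ℝ) < M - (1 - Real.cos s))]

/-- If `‖momentum φ‖ < 1`, the smaller cluster is nonempty. Rotating one of its phases by `s` raises
`2 * N * potential` by `2 * (M + 1) * (1 - cos s)`. -/
theorem not_isLocalMax_potential {φ : Torus N} (hφ : φ ∈ critical N)
    (hp : momentum φ ≠ 0) (hp1 : ‖momentum φ‖ < 1) : ¬ IsLocalMax potential φ := by
  intro hmax
  have hN0 : N ≠ 0 := by rintro rfl; simp [momentum] at hp
  obtain ⟨u, hu, σ, hσ, hz, hpos⟩ := exists_sign_of_mem_critical hφ hp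
  obtain ⟨i, hi⟩ : ∃ i, σ i = -1 := by
    by_contra! hcon
    have h1 : ∀ k, σ k = 1 := fun k => (hσ k).resolve_right (hcon k)
    have h2 := norm_sum_of_sign hu hz hpos
    rw [← nat_mul_momentum hN0, norm_mul, Complex.norm_natCast] at h2
    simp only [h1, Finset.sum_const, Finset.card_univ, Fintype.card_fin, nsmul_eq_mul, mul_one,
      Int.cast_natCast] at h2
    have hN' : (0 : ℝ) < N := by exact_mod_cast Nat.pos_of_ne_zero hN0
    nlinarith
  set γ : ℝ → Torus N := fun s => φ + Pi.single i (s : Real.Angle) with hγ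
  have hγc : Continuous γ :=
    continuous_const.add ((continuous_single (A := fun _ => Real.Angle) i).comp Real.Angle.continuous_coe)
  have hγ0 : γ 0 = φ := by simp [hγ]
  set M : ℤ := ∑ k, σ k with hM
  have hM1 : (1 : ℝ) ≤ M := by exact_mod_cast hpos
  have hsum : ∑ k, ((φ k).toCircle : ℂ) = (M : ℂ) * u := by
    rw [hM, Int.cast_sum, Finset.sum_mul]
    exact Finset.sum_congr rfl fun k _ => hz k
  have hval : ∀ s, 2 * N * potential (γ s) = (M + 1 - Real.cos s) ^ 2 + Real.sin s ^ 2 := by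
    intro s
    rw [two_mul_potential hN0, hγ, sum_toCircle_update, hsum, hz i, hi]
    have : (M : ℂ) * u + ((-1 : ℤ) : ℂ) * u * (((s : Real.Angle).toCircle : ℂ) - 1) =
        (((M + 1 - Real.cos s : ℝ) : ℂ) + ((- Real.sin s : ℝ) : ℂ) * Complex.I) * u := by
      rw [Real.Angle.toCircle_coe, Circle.coe_exp, Complex.exp_mul_I]
      push_cast
      ring
    rw [this, norm_mul, hu, mul_one, Complex.sq_norm, Complex.normSq_add_mul_I]
    ring
  have hev : ∀ᶠ s in 𝓝 (0 : ℝ), potential (γ s) ≤ potential φ :=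
    (hγc.tendsto' 0 φ hγ0).eventually hmax
  obtain ⟨s, ⟨hs, hs1⟩, hs0 : s ∈ Ioi (0:ℝ)⟩ := ((hev.filter_mono nhdsWithin_le_nhds |>.and
    ((gt_mem_nhds one_pos).filter_mono nhdsWithin_le_nhds)).and
      (self_mem_nhdsWithin : Ioi (0 : ℝ) ∈ 𝓝[>] 0)).exists
  simp only [mem_Ioi] at hs0
  have h2 : Real.cos s < 1 := by
    simpa using Real.cos_lt_cos_of_nonneg_of_le_pi le_rfl (by linarith [Real.pi_gt_three]) hs0
  have h3 : 2 * N * potential φ = M ^ 2 := by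
    have := hval 0; rw [hγ0] at this; simpa using this
  have h4 : (M + 1 - Real.cos s) ^ 2 + Real.sin s ^ 2 ≤ (M : ℝ) ^ 2 := by
    rw [← h3, ← hval]; gcongr
  nlinarith [Real.sin_sq_add_cos_sq s]

end

end Unicycle

/-- Barbalat's lemma for a nonnegative function that decreases at a uniformly continuous rate. -/
theorem tendsto_zero_of_hasDerivWithinAt_neg {f h : ℝ → ℝ}
    (hf : ∀ t, 0 ≤ t → HasDerivWithinAt f (-h t) (Ici 0) t) (hf0 : ∀ t, 0 ≤ t → 0 ≤ f t)
    (hh0 : ∀ t, 0 ≤ t → 0 ≤ h t) (hh : UniformContinuousOn h (Ici 0)) :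
    Tendsto h atTop (𝓝 0) := by
  have hfc : ContinuousOn f (Ici 0) := fun t ht => (hf t ht).continuousWithinAt
  have hanti : AntitoneOn f (Ici 0) :=
    antitoneOn_of_hasDerivWithinAt_nonpos (convex_Ici 0) hfc
      (fun t ht => (hf t (interior_subset ht)).mono interior_subset)
      fun t ht => neg_nonpos.2 (hh0 t (interior_subset ht))
  obtain ⟨L, hL⟩ : ∃ L, Tendsto f atTop (𝓝 L) := by
    have hg : Antitone fun t => f (max t 0) := fun s t hst =>
      hanti (le_max_right s 0) (le_max_right t 0) (max_le_max_right 0 hst)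
    have hb : BddBelow (range fun t => f (max t 0)) :=
      ⟨0, by rintro _ ⟨t, rfl⟩; exact hf0 _ (le_max_right t 0)⟩
    refine ⟨_, (tendsto_atTop_ciInf hg hb).congr' ?_⟩
    filter_upwards [eventually_ge_atTop 0] with t ht
    rw [max_eq_left ht]
  rw [Metric.tendsto_atTop]
  intro ε hε
  obtain ⟨δ, hδ, hu⟩ := Metric.uniformContinuousOn_iff.1 hh (ε / 2) (by positivity)
  -- If `ε ≤ h t`, then `h ≥ ε / 2` for time `δ / 2`, so `f` drops by at least `ε * δ / 4`; being
  -- within `ε * δ / 8` of its limit at both ends forbids this.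
  obtain ⟨T, hT⟩ := Metric.tendsto_atTop.1 hL (ε * δ / 8) (by positivity)
  refine ⟨max T 0, fun t ht => ?_⟩
  have htT : T ≤ t := (le_max_left _ _).trans ht
  have ht0 : 0 ≤ t := (le_max_right _ _).trans ht
  rw [Real.dist_0_eq_abs, abs_of_nonneg (hh0 t ht0)]
  by_contra! hcon
  have hlow : ∀ s ∈ Ico t (t + δ / 2), ε / 2 ≤ h s := by
    intro s hs
    have := hu s (ht0.trans hs.1) t ht0 (by
      rw [Real.dist_eq, abs_of_nonneg (by linarith [hs.1])]; linarith [hs.2])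
    rw [Real.dist_eq] at this
    linarith [neg_lt_of_abs_lt this]
  have hB : ∀ s, HasDerivAt (fun s => f t - ε / 2 * (s - t)) (-(ε / 2)) s := fun s => by
    simpa using (((hasDerivAt_id s).sub_const t).const_mul (ε / 2)).const_sub (f t)
  have hend := image_le_of_deriv_right_le_deriv_boundary (a := t) (b := t + δ / 2)
    (hfc.mono fun s hs => ht0.trans hs.1)
    (fun s hs => (hf s (ht0.trans hs.1)).mono (Ici_subset_Ici.2 (ht0.trans hs.1)))
    (B := fun s => f t - ε / 2 * (s - t)) (B' := fun _ => -(ε / 2)) (by simp)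
    (fun s _ => (hB s).continuousAt.continuousWithinAt) (fun s _ => (hB s).hasDerivWithinAt)
    (fun s hs => neg_le_neg (hlow s hs)) (right_mem_Icc.2 (by linarith))
  have h1 := hT t htT
  have h2 := hT (t + δ / 2) (by linarith)
  rw [Real.dist_eq] at h1 h2
  have h3 := lt_of_abs_lt h1
  have h4 := neg_lt_of_abs_lt h2
  nlinarith

instance Real.Angle.instCompactSpace : CompactSpace Real.Angle :=
  haveI : Fact (0 < 2 * Real.pi) := ⟨Real.two_pi_pos⟩
  inferInstanceAs (CompactSpace (AddCircle (2 * Real.pi)))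

/-! ### Lyapunov analysis along solutions -/

namespace Unicycle

noncomputable section

variable {N : ℕ} {K : Fin N → ℝ} {r : ℝ → Fin N → ℂ} {θ : ℝ → Fin N → ℝ}

/-- The rate `∑ₖ Kₖ Tₖ` at which the potential decreases along solutions. -/
def dissipation (K : Fin N → ℝ) (θ : Torus N) : ℝ := ∑ k, K k * termT k θ

theorem continuous_dissipation (K : Fin N → ℝ) : Continuous (dissipation K) := by
  unfold dissipation
  simp only [termT_eq]
  exact continuous_finsetSum _ fun k _ => continuous_const.mul ((continuous_gradient k).pow 2)

theorem dissipation_eq_zero {φ : Torus N} (h : φ ∈ critical N) : dissipation K φ = 0 :=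
  Finset.sum_eq_zero fun k _ => by simp [termT, h k]

theorem GainCondition.dissipation_nonneg {D : Set (Torus N)} (h : GainCondition K D)
    {φ : Torus N} (hφ : φ ∈ D) : 0 ≤ dissipation K φ := by
  by_cases hc : φ ∈ critical N
  · exact (dissipation_eq_zero hc).ge
  · exact (h φ hφ hc).le

theorem GainCondition.mono {D E : Set (Torus N)} (h : GainCondition K D) (hE : E ⊆ D) :
    GainCondition K E := fun φ hφ => h φ (hE hφ)

theorem gainCondition_of_pos (hK : ∀ k, 0 < K k) (D : Set (Torus N)) : GainCondition K D := by
  intro φ _ hφ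
  obtain ⟨k, hk⟩ : ∃ k, pderiv k potential φ ≠ 0 := not_forall.1 hφ
  refine Finset.sum_pos' (fun j _ => mul_nonneg (hK j).le (sq_nonneg _)) ⟨k, Finset.mem_univ k, ?_⟩
  exact mul_pos (hK k) (sq_pos_of_ne_zero hk)

theorem abs_gradient_le_one (k : Fin N) (φ : Torus N) : |gradient k φ| ≤ 1 := by
  refine (abs_real_inner_le_norm _ _).trans ?_
  rw [norm_mul, Complex.norm_I, Circle.norm_coe, one_mul, mul_one]
  exact norm_momentum_le_one φ

theorem uniformContinuous_toTorus : UniformContinuous (toTorus : (Fin N → ℝ) → Torus N) := by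
  have h : UniformContinuous (Real.Angle.coeHom : ℝ → Real.Angle) :=
    uniformContinuous_addMonoidHom_of_continuous Real.Angle.continuous_coe
  exact uniformContinuous_pi.2 fun k => h.comp (Pi.uniformContinuous_proj _ k)

namespace IsSolution

theorem hasDerivWithinAt_potential (h : IsSolution K r θ) (hN : N ≠ 0) {t : ℝ} (ht : 0 ≤ t) :
    HasDerivWithinAt (fun τ => potential (toTorus (θ τ))) (-dissipation K (toTorus (θ t)))
      (Ici 0) t := by
  refine (Unicycle.hasDerivWithinAt_potential hN (h.heading t ht)).congr_deriv ?_
  rw [dissipation, ← Finset.sum_neg_distrib]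
  refine Finset.sum_congr rfl fun k _ => ?_
  rw [control_eq, termT_eq]
  ring

theorem continuousOn_potential (h : IsSolution K r θ) (hN : N ≠ 0) :
    ContinuousOn (fun τ => potential (toTorus (θ τ))) (Ici 0) := fun _ ht =>
  (h.hasDerivWithinAt_potential hN ht).continuousWithinAt

theorem antitoneOn_potential (h : IsSolution K r θ) (hN : N ≠ 0)
    (hd : ∀ t, 0 ≤ t → 0 ≤ dissipation K (toTorus (θ t))) :
    AntitoneOn (fun τ => potential (toTorus (θ τ))) (Ici 0) :=
  antitoneOn_of_hasDerivWithinAt_nonpos (convex_Ici 0) (h.continuousOn_potential hN)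
    (fun _ ht => (h.hasDerivWithinAt_potential hN (interior_subset ht)).mono interior_subset)
    fun t ht => neg_nonpos.2 (hd t (interior_subset ht))

/-- Sublevel sets of the potential on which it does not increase are forward invariant. -/
theorem potential_le (h : IsSolution K r θ) (hN : N ≠ 0) {m : ℝ}
    (hm : ∀ φ : Torus N, potential φ < m → 0 ≤ dissipation K φ)
    (h0 : potential (toTorus (θ 0)) < m) {t : ℝ} (ht : 0 ≤ t) :
    potential (toTorus (θ t)) ≤ potential (toTorus (θ 0)) := by
  set g : ℝ → ℝ := fun τ => potential (toTorus (θ τ)) with hg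
  change g t ≤ g 0
  refine le_of_forall_pos_lt_add fun η hη => ?_
  -- Slope of a barrier `g 0 + ε * s` that stays below both `m` and `g 0 + η` up to time `t`. At a
  -- contact the potential is below `m`, so its derivative is at most `0 < ε`.
  set ε := min (η / 2) ((m - g 0) / 2) / (t + 1) with hε
  have hmin : 0 < min (η / 2) ((m - g 0) / 2) := lt_min (by linarith) (by
    have : g 0 < m := h0
    linarith)
  have hε0 : 0 < ε := by positivity
  have hεt : ∀ s ≤ t, ε * s < min (η / 2) ((m - g 0) / 2) := by
    intro s hs
    have h1 : ε * (t + 1) = min (η / 2) ((m - g 0) / 2) := by rw [hε]; field_simp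
    rw [← h1]
    exact mul_lt_mul_of_pos_left (by linarith) hε0
  have hB : ∀ s, HasDerivAt (fun s => g 0 + ε * s) ε s := fun s => by
    simpa using ((hasDerivAt_id s).const_mul ε).const_add (g 0)
  have hend := image_le_of_deriv_right_lt_deriv_boundary (a := 0) (b := t)
    ((h.continuousOn_potential hN).mono Icc_subset_Ici_self)
    (fun s hs => (h.hasDerivWithinAt_potential hN hs.1).mono (Ici_subset_Ici.2 hs.1))
    (B := fun s => g 0 + ε * s) (B' := fun _ => ε) (by simp [hg]) hB
    (fun s hs heq => by
      have h1 : g s = g 0 + ε * s := heq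
      have h2 := (hεt s hs.2.le).trans_le (min_le_right _ _)
      have h0' : g 0 < m := h0
      have h3 := hm (toTorus (θ s)) (show g s < m by linarith)
      linarith) (right_mem_Icc.2 ht)
  have h5 : g t ≤ g 0 + ε * t := hend
  have := (hεt t le_rfl).trans_le (min_le_left _ _)
  linarith

theorem uniformContinuousOn (h : IsSolution K r θ) : UniformContinuousOn θ (Ici 0) := by
  rw [uniformContinuousOn_iff_restrict, uniformContinuous_pi]
  intro k
  have hl : LipschitzOnWith ‖K k‖₊ (fun s => θ s k) (Ici 0) := by
    refine Convex.lipschitzOnWith_of_nnnorm_hasDerivWithin_le (convex_Ici 0)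
      (fun t ht => h.heading t ht k) fun t _ => ?_
    rw [control_eq, nnnorm_mul, nnnorm_neg, ← NNReal.coe_le_coe]
    push_cast
    rw [Real.norm_eq_abs (gradient _ _)]
    exact mul_le_of_le_one_right (norm_nonneg _) (abs_gradient_le_one _ _)
  exact uniformContinuousOn_iff_restrict.1 hl.uniformContinuousOn

theorem tendsto_dissipation (h : IsSolution K r θ) (hN : N ≠ 0)
    (hd : ∀ t, 0 ≤ t → 0 ≤ dissipation K (toTorus (θ t))) :
    Tendsto (fun t => dissipation K (toTorus (θ t))) atTop (𝓝 0) :=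
  tendsto_zero_of_hasDerivWithinAt_neg (fun _ ht => h.hasDerivWithinAt_potential hN ht)
    (fun _ _ => potential_nonneg _) hd
    ((CompactSpace.uniformContinuous_of_continuous (continuous_dissipation K)).comp
      uniformContinuous_toTorus |>.comp_uniformContinuousOn h.uniformContinuousOn)

/-- Outside an open neighbourhood of `critical N ∩ D`, the compact remainder of `D` carries a
positive lower bound for the dissipation, which tends to zero along the solution. -/
theorem convergesTo_critical (h : IsSolution K r θ) (hN : N ≠ 0) {D : Set (Torus N)}
    (hD : IsClosed D) (hg : GainCondition K D) (hθ : ∀ t, 0 ≤ t → toTorus (θ t) ∈ D) :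
    ConvergesTo θ (critical N ∩ D) := by
  intro V hV
  obtain ⟨O, hO, hAO, hOV⟩ := mem_nhdsSet_iff_exists.1 hV
  obtain ⟨c, hc, hcle⟩ := (hD.sdiff hO).isCompact.exists_forall_le'
    (continuous_dissipation K).continuousOn (a := 0)
    fun φ hφ => hg φ hφ.1 fun hcr => hφ.2 (hAO ⟨hcr, hφ.1⟩)
  have hev := (h.tendsto_dissipation hN fun t ht => hg.dissipation_nonneg (hθ t ht)).eventually
    (gt_mem_nhds hc)
  rw [mem_map]
  filter_upwards [hev, eventually_ge_atTop 0] with t ht ht0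
  by_contra hcon
  exact (hcle _ ⟨hθ t ht0, fun hmem => hcon (hOV hmem)⟩).not_gt ht

end IsSolution

/-- Serves to discard the part of a limit set that the trajectory eventually avoids: if `O` is an
open neighbourhood of `B`, then `O ∪ Cᶜ` is one of `A`. -/
theorem ConvergesTo.of_eventually_mem {A B C : Set (Torus N)} (h : ConvergesTo θ A)
    (hC : IsClosed C) (hev : ∀ᶠ t in atTop, toTorus (θ t) ∈ C) (hsub : A ∩ C ⊆ B) :
    ConvergesTo θ B := by
  intro V hV
  obtain ⟨O, hO, hBO, hOV⟩ := mem_nhdsSet_iff_exists.1 hV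
  have hA : O ∪ Cᶜ ∈ 𝓝ˢ A := (hO.union hC.isOpen_compl).mem_nhdsSet.2 fun φ hφ => by
    by_cases hc : φ ∈ C
    · exact Or.inl (hBO (hsub ⟨hφ, hc⟩))
    · exact Or.inr hc
  rw [mem_map]
  filter_upwards [h hA, hev] with t ht htC
  exact hOV (ht.resolve_right fun hn => hn htC)

theorem ConvergesTo.tendsto_momentum (h : ConvergesTo θ (balanced N)) :
    Tendsto (fun t => momentum (toTorus (θ t))) atTop (𝓝 0) := by
  suffices hs : Tendsto momentum (𝓝ˢ (balanced N)) (𝓝 0) from hs.comp h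
  intro V hV
  obtain ⟨O, hOV, hO, h0⟩ := mem_nhds_iff.1 hV
  refine mem_of_superset ((hO.preimage continuous_momentum).mem_nhdsSet.2 ?_)
    (preimage_mono hOV)
  intro φ hφ
  rw [mem_preimage, show momentum φ = 0 from hφ]
  exact h0

theorem sublevel_mem_nhdsSet_balanced {m : ℝ} (hm : 0 < m) :
    {φ : Torus N | potential φ < m} ∈ 𝓝ˢ (balanced N) :=
  (isOpen_lt continuous_potential continuous_const).mem_nhdsSet.2 fun φ hφ => by
    simpa [potential, show momentum φ = 0 from hφ] using hm

/-- By compactness the potential has a positive lower bound off any open neighbourhood of its zero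
set. -/
theorem exists_sublevel_subset (hN : N ≠ 0) {V : Set (Torus N)} (hV : V ∈ 𝓝ˢ (balanced N)) :
    ∃ m > 0, {φ : Torus N | potential φ < m} ⊆ V := by
  obtain ⟨O, hO, hBO, hOV⟩ := mem_nhdsSet_iff_exists.1 hV
  obtain ⟨m, hm, hle⟩ := hO.isClosed_compl.isCompact.exists_forall_le'
    continuous_potential.continuousOn (a := 0) fun φ hφ =>
      (potential_nonneg φ).lt_of_ne' fun h0 => hφ (hBO ((mem_balanced_iff_potential hN).2 h0))
  refine ⟨m, hm, fun φ hφ => hOV ?_⟩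
  by_contra hcon
  exact (hle φ hcon).not_gt hφ

theorem mem_balanced_of_mem_critical (hN : N ≠ 0) {φ : Torus N} (hφ : φ ∈ critical N)
    (h : 2 * N * potential φ < 1) : φ ∈ balanced N := by
  obtain ⟨m, hm⟩ := exists_int_potential_eq hN hφ
  rw [hm] at h
  have h1 : m ^ 2 < 1 := by exact_mod_cast h
  have h2 : m ^ 2 = 0 := le_antisymm (by omega) (sq_nonneg m)
  have h3 : (m : ℝ) ^ 2 = 0 := by exact_mod_cast h2
  rw [mem_balanced_iff_potential hN]
  simpa [h3, hN] using hm

theorem isAsymptoticallyStable_balanced (hN : N ≠ 0) {D : Set (Torus N)}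
    (hD : D ∈ 𝓝ˢ (balanced N)) (hg : GainCondition K D) :
    IsAsymptoticallyStable K (balanced N) := by
  have hN' : (0 : ℝ) < N := by exact_mod_cast Nat.pos_of_ne_zero hN
  constructor
  · intro V hV
    obtain ⟨m, hm, hsub⟩ := exists_sublevel_subset hN (inter_mem hV hD)
    refine ⟨_, sublevel_mem_nhdsSet_balanced hm, fun r θ h h0 t ht => ?_⟩
    have := h.potential_le hN (fun φ hφ => hg.dissipation_nonneg (hsub hφ).2) h0 ht
    exact (hsub (this.trans_lt h0)).1
  · obtain ⟨m, hm, hsub⟩ := exists_sublevel_subset hN hD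
    -- The bound `m` keeps the sublevel set in `D`; `1 / (2 * N)` excludes unbalanced critical
    -- points.
    refine ⟨_, sublevel_mem_nhdsSet_balanced (m := min m (1 / (2 * N))) (by positivity),
      fun r θ h h0 => ?_⟩
    have h0' : potential (toTorus (θ 0)) < min m (1 / (2 * N)) := h0
    have hle : ∀ t, 0 ≤ t → potential (toTorus (θ t)) ≤ potential (toTorus (θ 0)) := fun t ht =>
      h.potential_le hN (fun φ hφ => hg.dissipation_nonneg (hsub hφ))
        (h0'.trans_le (min_le_left _ _)) ht
    have hconv := h.convergesTo_critical hN
      (D := {φ | potential φ ≤ potential (toTorus (θ 0))})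
      (isClosed_le continuous_potential continuous_const)
      (hg.mono fun φ hφ => hsub (lt_of_le_of_lt hφ (h0'.trans_le (min_le_left _ _)))) hle
    refine hconv.mono_right (nhdsSet_mono ?_)
    rintro φ ⟨hφ, hφ0⟩
    refine mem_balanced_of_mem_critical hN hφ ?_
    have := lt_of_le_of_lt hφ0 (h0'.trans_le (min_le_right _ _))
    rw [lt_div_iff₀ (by positivity)] at this
    linarith

/-- The potential is nonincreasing: either it falls below `1 / (2 * N)` and stays there, or it never
does. Each case leaves only one kind of critical point. -/
theorem convergesTo_balanced_or (hN : N ≠ 0) (hg : GainCondition K univ)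
    (h : IsSolution K r θ) :
    ConvergesTo θ (balanced N) ∨ ConvergesTo θ (critical N \ balanced N) := by
  have hconv := h.convergesTo_critical hN isClosed_univ hg fun _ _ => mem_univ _
  have hanti := h.antitoneOn_potential hN fun t _ => hg.dissipation_nonneg (mem_univ _)
  have hcont : Continuous fun φ : Torus N => 2 * N * potential φ :=
    continuous_const.mul continuous_potential
  by_cases hsmall : ∃ t, 0 ≤ t ∧ 2 * N * potential (toTorus (θ t)) < 1
  · obtain ⟨t, ht, hlt⟩ := hsmall
    left
    refine hconv.of_eventually_mem
      (C := {φ | 2 * N * potential φ ≤ 2 * N * potential (toTorus (θ t))})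
      (isClosed_le hcont continuous_const) ?_ ?_
    · filter_upwards [eventually_ge_atTop t] with s hs
      exact mul_le_mul_of_nonneg_left (hanti ht (ht.trans hs) hs) (by positivity)
    · rintro φ ⟨⟨hφ, -⟩, hle⟩
      exact mem_balanced_of_mem_critical hN hφ (lt_of_le_of_lt hle hlt)
  · push Not at hsmall
    right
    refine hconv.of_eventually_mem (C := {φ | 1 ≤ 2 * N * potential φ})
      (isClosed_le continuous_const hcont) ?_ ?_
    · filter_upwards [eventually_ge_atTop 0] with s hs using hsmall s hs
    · rintro φ ⟨⟨hφ, -⟩, hle : 1 ≤ 2 * N * potential φ⟩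
      refine ⟨hφ, fun hb => ?_⟩
      rw [(mem_balanced_iff_potential hN).1 hb] at hle
      norm_num at hle

end

end Unicycle

/-! ### Global existence of solutions and instability -/

open scoped NNReal in
/-- Global existence for an autonomous differential equation with a bounded Lipschitz field. -/
theorem exists_hasDerivAt_of_lipschitzWith {E : Type*} [NormedAddCommGroup E] [NormedSpace ℝ E]
    [CompleteSpace E] {v : E → E} {C L : ℝ≥0} (hv : LipschitzWith C v) (hL : ∀ x, ‖v x‖ ≤ L)
    (x₀ : E) : ∃ x : ℝ → E, x 0 = x₀ ∧ ∀ t, HasDerivAt x (v (x t)) t := by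
  have hloc : ∀ n : ℕ, ∃ α : ℝ → E, α 0 = x₀ ∧
      ∀ t ∈ Ioo (-(n : ℝ)) n, HasDerivAt α (v (α t)) t := by
    intro n
    have hn : (0 : ℝ) ∈ Icc (-(n : ℝ)) n := by simp
    -- At speed at most `L`, a solution stays within distance `L * n` of `x₀` during time `n`, so
    -- existence on the whole interval follows.
    have hp : IsPicardLindelof (fun _ => v) (⟨0, hn⟩ : Icc (-(n : ℝ)) n) x₀ (L * n) 0 L C :=
      { lipschitzOnWith := fun _ _ => hv.lipschitzOnWith
        continuousOn := fun _ _ => continuousOn_const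
        norm_le := fun _ _ x _ => hL x
        mul_max_le := by simp }
    obtain ⟨α, h0, hα⟩ := hp.exists_eq_forall_mem_Icc_hasDerivWithinAt₀
    exact ⟨α, h0, fun t ht => (hα t (Ioo_subset_Icc_self ht)).hasDerivAt (Icc_mem_nhds ht.1 ht.2)⟩
  choose α h0 hα using hloc
  have huniq : ∀ m n : ℕ, m ≤ n → EqOn (α m) (α n) (Ioo (-(m : ℝ)) m) := by
    intro m n hmn
    rcases Nat.eq_zero_or_pos m with rfl | hm
    · simp
    have hmn' : (m : ℝ) ≤ n := by exact_mod_cast hmn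
    have hm' : (0 : ℝ) < m := by exact_mod_cast hm
    exact ODE_solution_unique_of_mem_Ioo (v := fun _ => v) (s := fun _ => univ) (t₀ := 0)
      (fun _ _ => hv.lipschitzOnWith) (by simp [hm'])
      (fun t ht => ⟨hα m t ht, mem_univ _⟩)
      (fun t ht => ⟨hα n t ⟨by linarith [ht.1], by linarith [ht.2]⟩, mem_univ _⟩)
      (by rw [h0, h0])
  -- The index `⌊|t|⌋₊ + 1` is the least natural number exceeding `|t|`; uniqueness makes every
  -- larger index agree with it.
  have hin : ∀ (t : ℝ) (n : ℕ), |t| < n → α (⌊|t|⌋₊ + 1) t = α n t := by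
    intro t n ht
    refine huniq _ _ ?_ (abs_lt.1 (by exact_mod_cast Nat.lt_floor_add_one |t|))
    exact (Nat.floor_lt (abs_nonneg t)).2 ht
  refine ⟨fun t => α (⌊|t|⌋₊ + 1) t, h0 _, fun t => ?_⟩
  obtain ⟨n, hn⟩ := exists_nat_gt |t|
  have hev : (fun s => α (⌊|s|⌋₊ + 1) s) =ᶠ[𝓝 t] α n := by
    filter_upwards [continuous_abs.continuousAt.eventually (gt_mem_nhds hn)] with s hs
    exact hin s n hs
  simp only [hin t n hn]
  exact (hα n t (abs_lt.1 hn)).congr_of_eventuallyEq hev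

namespace Unicycle

noncomputable section

variable {N : ℕ} {K : Fin N → ℝ}

/-- This sine-coupling form yields the Lipschitz bound needed for existence. -/
theorem gradient_toTorus (k : Fin N) (x : Fin N → ℝ) :
    gradient k (toTorus x) = (1 / N) * ∑ j, Real.sin (x j - x k) := by
  have hmom : momentum (toTorus x) = (1 / (N : ℝ)) • ∑ j, ((toTorus x j).toCircle : ℂ) := by
    simp [momentum, Complex.real_smul]
  rw [gradient, hmom, real_inner_smul_left, sum_inner]
  congr 1
  refine Finset.sum_congr rfl fun j _ => ?_
  rw [coe_toCircle_toTorus, coe_toCircle_toTorus, Complex.inner, Complex.exp_mul_I,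
    Complex.exp_mul_I, Real.sin_sub]
  simp [← Complex.ofReal_cos, ← Complex.ofReal_sin]
  ring

theorem abs_gradient_sub_le (k : Fin N) (x y : Fin N → ℝ) :
    |gradient k (toTorus x) - gradient k (toTorus y)| ≤ 2 * dist x y := by
  have hN : (0 : ℝ) < N := by exact_mod_cast k.pos
  have hj : ∀ j, |Real.sin (x j - x k) - Real.sin (y j - y k)| ≤ 2 * dist x y := by
    intro j
    refine (Real.abs_sin_sub_sin_le _ _).trans ?_
    have h1 : |x j - y j| ≤ dist x y := by simpa [Real.dist_eq] using dist_le_pi_dist x y j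
    have h2 : |x k - y k| ≤ dist x y := by simpa [Real.dist_eq] using dist_le_pi_dist x y k
    rw [abs_le] at *
    constructor <;> linarith
  rw [gradient_toTorus, gradient_toTorus, ← mul_sub, ← Finset.sum_sub_distrib, abs_mul,
    abs_of_pos (by positivity)]
  calc 1 / (N : ℝ) * |∑ j, (Real.sin (x j - x k) - Real.sin (y j - y k))|
      ≤ 1 / N * ∑ _j : Fin N, 2 * dist x y := by
        gcongr
        exact (Finset.abs_sum_le_sum_abs _ _).trans (Finset.sum_le_sum fun j _ => hj j)
    _ = 2 * dist x y := by simp; field_simp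

/-- The closed loop has a solution for every initial phase arrangement. -/
theorem exists_isSolution (K : Fin N → ℝ) (φ : Torus N) :
    ∃ r θ, IsSolution K r θ ∧ toTorus (θ 0) = φ := by
  obtain ⟨x₀, rfl⟩ := exists_toTorus_eq φ
  have hlip : LipschitzWith (2 * ‖K‖₊) fun x : Fin N → ℝ => control K (toTorus x) := by
    refine LipschitzWith.of_dist_le_mul fun x y => ?_
    refine (dist_pi_le_iff (by positivity)).2 fun k => ?_
    rw [Real.dist_eq, control_eq, control_eq, ← mul_sub, abs_mul, abs_neg]
    calc |K k| * |gradient k (toTorus x) - gradient k (toTorus y)|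
        ≤ ‖K‖ * (2 * dist x y) :=
          mul_le_mul (norm_le_pi_norm K k) (abs_gradient_sub_le k x y) (abs_nonneg _)
            (norm_nonneg _)
      _ = ((2 * ‖K‖₊ : NNReal) : ℝ) * dist x y := by push_cast; ring
  have hbd : ∀ x : Fin N → ℝ, ‖control K (toTorus x)‖ ≤ ‖K‖₊ := fun x =>
    (pi_norm_le_iff_of_nonneg (by positivity)).2 fun k => by
      rw [control_eq, norm_mul, norm_neg]
      exact (mul_le_of_le_one_right (norm_nonneg _) (abs_gradient_le_one _ _)).trans
        (norm_le_pi_norm K k)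
  obtain ⟨θ, h0, hθ⟩ := exists_hasDerivAt_of_lipschitzWith hlip hbd x₀
  have hc : ∀ k, Continuous fun s => Complex.exp (Complex.I * (θ s k : ℂ)) := fun k => by
    have h1 : Continuous θ := continuous_iff_continuousAt.2 fun t => (hθ t).continuousAt
    fun_prop
  refine ⟨fun t k => ∫ s in (0 : ℝ)..t, Complex.exp (Complex.I * (θ s k : ℂ)), θ,
    ⟨fun t _ k => ?_, fun t _ k => ?_⟩, by rw [h0]⟩
  · exact ((hc k).integral_hasStrictDerivAt 0 t).hasDerivAt.hasDerivWithinAt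
  · exact (hasDerivAt_pi.1 (hθ t) k).hasDerivWithinAt

/-- Stability would trap a solution started at a nearby lower point in a band of potential values
containing no critical value, yet it must converge to critical points in that band. -/
theorem not_isStable_of_not_isLocalMin (hN : N ≠ 0) (hg : GainCondition K univ) {φ : Torus N}
    (hφ : φ ∈ critical N) (hmin : ¬ IsLocalMin potential φ) : ¬ IsStable K {φ} := by
  intro hst
  have hN' : (0 : ℝ) < N := by exact_mod_cast Nat.pos_of_ne_zero hN
  -- Half of `1 / (2 * N)`, the least possible gap between critical values.
  set a := potential φ - 1 / (4 * N) with ha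
  have ha' : a < potential φ := by
    have : 0 < 1 / (4 * (N : ℝ)) := by positivity
    linarith
  obtain ⟨W, hW, hWV⟩ := hst {ψ | a < potential ψ} <|
    (isOpen_lt continuous_const continuous_potential).mem_nhdsSet.2 (by simpa using ha')
  rw [nhdsSet_singleton] at hW
  obtain ⟨ψ, hψ, hψW⟩ : ∃ ψ, potential ψ < potential φ ∧ ψ ∈ W := by
    by_contra! hcon
    exact hmin (mem_of_superset hW fun ψ hψ => not_lt.1 fun hlt => hcon ψ hlt hψ)
  obtain ⟨r, θ, h, rfl⟩ := exists_isSolution K ψ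
  have hanti := h.antitoneOn_potential hN fun t _ => hg.dissipation_nonneg (mem_univ _)
  have hconv := h.convergesTo_critical hN
    (D := {χ | a ≤ potential χ} ∩ {χ | potential χ ≤ potential (toTorus (θ 0))})
    ((isClosed_le continuous_const continuous_potential).inter
      (isClosed_le continuous_potential continuous_const)) (hg.mono (subset_univ _))
    fun t ht => ⟨le_of_lt (show a < _ from hWV r θ h hψW t ht), hanti self_mem_Ici ht ht⟩
  have hempty : critical N ∩
      ({χ | a ≤ potential χ} ∩ {χ | potential χ ≤ potential (toTorus (θ 0))}) = ∅ := by
    refine eq_empty_of_forall_notMem ?_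
    rintro χ ⟨hχ, h1 : a ≤ potential χ, h2 : potential χ ≤ _⟩
    refine (potential_le_of_mem_critical hN hχ hφ ?_).not_gt (h2.trans_lt hψ)
    have h3 : 2 * N * a ≤ 2 * N * potential χ := by gcongr
    have h4 : 2 * N * a = 2 * N * potential φ - 1 / 2 := by rw [ha]; field_simp; ring
    linarith
  rw [ConvergesTo, hempty, nhdsSet_empty] at hconv
  -- Convergence to the empty set would force the image of `atTop` to be the trivial filter.
  exact (NeBot.map (f := atTop) inferInstance _).ne (le_bot_iff.1 hconv)

theorem isMaxOn_potential {φ : Torus N} (h : ‖momentum φ‖ = 1) : IsMaxOn potential univ φ := by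
  intro ψ _
  change potential ψ ≤ potential φ
  unfold potential
  rw [h]
  have := norm_momentum_le_one ψ
  gcongr

end

end Unicycle

open Unicycle in
theorem theorem1 (N : ℕ) (hN : 2 ≤ N) (K : Fin N → ℝ) :
    -- the condition near balanced formation makes balanced formation asymptotically stable
    (∀ D ∈ 𝓝ˢ (balanced N), GainCondition K D → IsAsymptoticallyStable K (balanced N)) ∧
    -- solutions in a closed region with the condition converge to the critical set there
    (∀ D : Set (Torus N), IsClosed D → GainCondition K D →
      ∀ r θ, IsSolution K r θ → (∀ t, 0 ≤ t → toTorus (θ t) ∈ D) →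
        ConvergesTo θ (critical N ∩ D) ∧
        (critical N ∩ D ⊆ balanced N →
          ConvergesTo θ (balanced N) ∧
          Tendsto (fun t => momentum (toTorus (θ t))) atTop (𝓝 0))) ∧
    -- positive gains
    ((∀ k, 0 < K k) →
      GainCondition K univ ∧
      IsAsymptoticallyStable K (balanced N) ∧
      (∀ r θ, IsSolution K r θ →
        ConvergesTo θ (balanced N) ∨ ConvergesTo θ (critical N \ balanced N)) ∧
      (∀ φ ∈ critical N, momentum φ ≠ 0 →
        ((‖momentum φ‖ = 1 ∧ IsMaxOn potential univ φ) ∨ (‖momentum φ‖ < 1 ∧ IsSaddle φ)) ∧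
        IsUnstableEquilibrium K φ)) := by
  have hN0 : N ≠ 0 := by omega
  refine ⟨fun D hD hg => isAsymptoticallyStable_balanced hN0 hD hg,
    fun D hD hg r θ h hθ => ?_, fun hK => ?_⟩
  · have hconv := h.convergesTo_critical hN0 hD hg hθ
    refine ⟨hconv, fun hsub => ?_⟩
    have hb : ConvergesTo θ (balanced N) := hconv.mono_right (nhdsSet_mono hsub)
    exact ⟨hb, hb.tendsto_momentum⟩
  · have hg := gainCondition_of_pos hK univ
    refine ⟨hg, isAsymptoticallyStable_balanced hN0 univ_mem hg,
      fun r θ h => convergesTo_balanced_or hN0 hg h, fun φ hφ hp => ?_⟩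
    have hmin := not_isLocalMin_potential hN hφ hp
    refine ⟨?_, fun k => by rw [control_eq, mem_critical_iff.1 hφ k, mul_zero],
      not_isStable_of_not_isLocalMin hN0 hg hφ hmin⟩
    rcases (norm_momentum_le_one φ).eq_or_lt with h1 | h1
    · exact Or.inl ⟨h1, isMaxOn_potential h1⟩
    · exact Or.inr ⟨h1, hφ, hmin, not_isLocalMax_potential hφ hp h1⟩
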